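/- Theorem 4.1. Let $L^1(\mathbb Z)$ be the Banach algebra of absolutely summable functions $F:\mathbb Z\to\mathbb C$ with norm $\|F\|_1=\sum_{k}|F(k)|$, convolution product $(F*G)(m)=\sum_{k\in\mathbb Z}F(k)G(m-k)$ and unit $\delta_0$; write $F^{(n)}$ for the $n$-th convolution power, $e^{A}=\sum_{k\ge0}A^{(k)}/k!$ for the exponential in this algebra, and $L(F)$ for the operator $G\mapsto F*G$ on $L^1(\mathbb Z)$. Let $F$ be a probability on $\mathbb Z^+=\{0,1,2,\dots\}$, that is, $F\in L^1(\mathbb Z)$, $F\ge0$, $\sum_kF(k)=1$ and $F(k)=0$ for $k<0$. Put $\widehat F(\xi)=\sum_{k}F(k)e^{-ik\xi}$ for $\xi\in[-\pi,\pi]$ and $\varphi_F(w)=\sum_{k\ge0}F(k)w^k$ for $|w|\le1$. Let $\mathbb D$ be the open unit disc and, for $\theta\in(0,\pi/2)$, let $\overline\Lambda_\theta=\{0\}\cup\{z\in\mathbb C\setminus\{0\}:|\operatorname{Arg}z|\le\theta\}$. A bounded operator $T$ on a complex Banach space is power-bounded if $\sup_{n\ge1}\|T^n\|<\infty$, and Ritt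 if it is power-bounded and $\sup_{n\ge1}n\|T^n-T^{n+1}\|<\infty$; for $T$ power-bounded put $\Psi(F;T)=\sum_{k\ge0}F(k)T^k$. Let $\mathcal A$ be the set of probabilities $F$ on $\mathbb Z^+$ with $\sup_{n\ge1}n\|F^{(n)}-F^{(n+1)}\|_1<\infty$. The following conditions are equivalent: (I) $F\in\mathcal A$; (II) $L(F)$ is a Ritt operator on $L^1(\mathbb Z)$; (III) for every complex Banach space $X$ and every power-bounded bounded linear operator $T$ on $X$, the operator $\Psi(F;T)$ is a Ritt operator; (IV) $\widehat F(\xi)\in\mathbb D\cup\{1\}$ for all $\xi\in[-\pi,\pi]$, and $\sup_{t\ge1}t\,\|(\delta_0-F)*e^{-t(\delta_0-F)}\|_1<\infty$. Moreover, if $F\in\mathcal A$, then there is a $\theta\in(0,\pi/2)$ such that $\varphi_F(w)\in\mathbb D\cup\{1\}$ and $1-\varphi_F(w)\in\overline\Lambda_\theta$ for all $w$ with $|w|\le1$. Finally, if $F\in\mathcal A$ and $F\ne\delta_0$, then $\sum_{k\ge0}kF(k)=+\infty$, and hence $\{k:F(k)\ne0\}$ is infinite. -/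

import Mathlib

open scoped ENNReal ComplexOrder

noncomputable section

namespace RittProb

/-- The Banach space `L¹(ℤ)` of absolutely summable functions `ℤ → ℂ`, with its usual norm.
Below it is made into a Banach algebra under convolution. -/
abbrev L1Z : Type := lp (fun _ : ℤ => ℂ) 1

namespace L1Z

lemma summable_norm (F : L1Z) : Summable fun k : ℤ => ‖F k‖ := by
  have h := (lp.memℓp F).summable (by simp)
  simpa using h

lemma norm_eq (F : L1Z) : ‖F‖ = ∑' k : ℤ, ‖F k‖ := by
  have h := lp.norm_eq_tsum_rpow (p := 1) (by simp) F
  simpa using h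

lemma memlp_of_summable {f : ℤ → ℂ} (hf : Summable fun k => ‖f k‖) :
    Memℓp (E := fun _ : ℤ => ℂ) f 1 :=
  memℓp_gen (by simpa using hf)

/-- The shear `(m, k) ↦ (k, m - k)` of `ℤ × ℤ`. -/
def shear : ℤ × ℤ ≃ ℤ × ℤ where
  toFun p := (p.2, p.1 - p.2)
  invFun q := (q.1 + q.2, q.1)
  left_inv p := by ext <;> simp
  right_inv q := by ext <;> simp

lemma summable_double {f g : ℤ → ℂ} (hf : Summable fun k => ‖f k‖)
    (hg : Summable fun k => ‖g k‖) :
    Summable fun p : ℤ × ℤ => ‖f p.2 * g (p.1 - p.2)‖ := by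
  have h := hf.mul_of_nonneg hg (fun _ => norm_nonneg _) (fun _ => norm_nonneg _)
  have h2 := (shear.summable_iff).2 h
  refine h2.congr ?_
  intro p
  simp [shear]

lemma summable_term (F G : L1Z) (m : ℤ) : Summable fun k : ℤ => ‖F k * G (m - k)‖ :=
  (summable_double F.summable_norm G.summable_norm).prod_factor m

lemma summable_conv (F G : L1Z) : Summable fun m : ℤ => ‖∑' k : ℤ, F k * G (m - k)‖ := by
  refine Summable.of_nonneg_of_le (fun _ => norm_nonneg _) (fun m => ?_)
    (summable_double F.summable_norm G.summable_norm).prod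
  exact norm_tsum_le_tsum_norm (summable_term F G m)

/-- Convolution: `(F * G)(m) = ∑_{k ∈ ℤ} F(k) G(m - k)`. -/
instance : Mul L1Z where
  mul F G := ⟨fun m : ℤ => ∑' k : ℤ, F k * G (m - k), memlp_of_summable (summable_conv F G)⟩

/-- The unit element `δ₀`. -/
instance : One L1Z where
  one := lp.single 1 (0 : ℤ) (1 : ℂ)

lemma mul_apply (F G : L1Z) (m : ℤ) : (F * G) m = ∑' k : ℤ, F k * G (m - k) := rfl

lemma one_apply (m : ℤ) : (1 : L1Z) m = if m = 0 then 1 else 0 := by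
  change (lp.single 1 (0 : ℤ) (1 : ℂ) : L1Z) m = _
  rw [lp.single_apply]
  by_cases h : m = 0
  · subst h; simp
  · simp [h]

lemma conv_comm (F G : L1Z) : F * G = G * F := by
  ext m
  rw [mul_apply, mul_apply, ← (Equiv.subLeft m).tsum_eq]
  refine tsum_congr fun k => ?_
  simp [mul_comm]

lemma conv_add (F G H : L1Z) : F * (G + H) = F * G + F * H := by
  ext m
  change _ = (F * G) m + (F * H) m
  rw [mul_apply, mul_apply, mul_apply,
    ← (summable_term F G m).of_norm.tsum_add (summable_term F H m).of_norm]
  refine tsum_congr fun k => ?_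
  change F k * (G (m - k) + H (m - k)) = _
  ring

lemma conv_smul (c : ℂ) (F G : L1Z) : F * (c • G) = c • (F * G) := by
  ext m
  change _ = c * (F * G) m
  rw [mul_apply, mul_apply, ← tsum_mul_left]
  refine tsum_congr fun k => ?_
  change F k * (c * G (m - k)) = _
  ring

lemma one_conv (F : L1Z) : 1 * F = F := by
  ext m
  rw [mul_apply, tsum_eq_single 0]
  · simp [one_apply]
  · intro k hk
    simp [one_apply, hk]

lemma conv_assoc (F G H : L1Z) : F * G * H = F * (G * H) := by
  ext m
  have hsum : Summable fun p : ℤ × ℤ => F p.2 * G (p.1 - p.2) * H (m - p.1) := by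
    refine Summable.of_norm ?_
    refine Summable.of_nonneg_of_le (fun _ => norm_nonneg _) (fun p => ?_)
      ((summable_double F.summable_norm G.summable_norm).mul_right ‖H‖)
    rw [norm_mul]
    exact mul_le_mul_of_nonneg_left (lp.norm_apply_le_norm (by simp) H _) (norm_nonneg _)
  calc (F * G * H) m
      = ∑' k : ℤ, ∑' j : ℤ, F j * G (k - j) * H (m - k) := by
        rw [mul_apply]
        refine tsum_congr fun k => ?_
        rw [mul_apply, tsum_mul_right]
    _ = ∑' j : ℤ, ∑' k : ℤ, F j * G (k - j) * H (m - k) := Summable.tsum_comm hsum.prod_symm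
    _ = (F * (G * H)) m := by
        rw [mul_apply]
        refine tsum_congr fun j => ?_
        rw [mul_apply, ← tsum_mul_left, ← (Equiv.addLeft j).tsum_eq]
        refine tsum_congr fun k => ?_
        simp only [Equiv.coe_addLeft, add_sub_cancel_left, mul_assoc, sub_sub]

lemma norm_conv_le (F G : L1Z) : ‖F * G‖ ≤ ‖F‖ * ‖G‖ := by
  have h := summable_double F.summable_norm G.summable_norm
  calc ‖F * G‖ = ∑' m : ℤ, ‖∑' k : ℤ, F k * G (m - k)‖ := norm_eq _
    _ ≤ ∑' m : ℤ, ∑' k : ℤ, ‖F k * G (m - k)‖ :=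
        (summable_conv F G).tsum_le_tsum
          (fun m => norm_tsum_le_tsum_norm (summable_term F G m)) h.prod
    _ = ∑' p : ℤ × ℤ, ‖F p.2 * G (p.1 - p.2)‖ := (h.tsum_prod).symm
    _ = ∑' q : ℤ × ℤ, ‖F q.1‖ * ‖G q.2‖ := by
        rw [← shear.tsum_eq (fun q : ℤ × ℤ => ‖F q.1‖ * ‖G q.2‖)]
        refine tsum_congr fun p => ?_
        simp [shear]
    _ = ‖F‖ * ‖G‖ := by
        rw [norm_eq F, norm_eq G]
        exact (F.summable_norm.tsum_mul_tsum G.summable_norm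
          (F.summable_norm.mul_of_nonneg G.summable_norm (fun _ => norm_nonneg _)
            (fun _ => norm_nonneg _))).symm

/-- `L¹(ℤ)` is a commutative normed ring under convolution, for its usual norm. -/
instance : NormedCommRing L1Z where
  __ := (inferInstance : NormedAddCommGroup L1Z)
  mul_assoc := conv_assoc
  one_mul := one_conv
  mul_one F := by rw [conv_comm, one_conv]
  mul_comm := conv_comm
  left_distrib := conv_add
  right_distrib F G H := by rw [conv_comm, conv_add, conv_comm H F, conv_comm H G]
  zero_mul F := by
    rw [conv_comm]
    simpa using conv_smul 0 F 0
  mul_zero F := by simpa using conv_smul 0 F 0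
  norm_mul_le := norm_conv_le

/-- `L¹(ℤ)` is a normed algebra over `ℂ`, for its usual vector space structure. -/
instance : NormedAlgebra ℂ L1Z where
  __ := Algebra.ofModule (R := ℂ) (A := L1Z)
    (fun c F G => by rw [mul_comm, conv_smul, mul_comm]) (fun c F G => conv_smul c F G)
  norm_smul_le c F := norm_smul_le c F

end L1Z

/-- The convolution operator `L(F)` on `L¹(ℤ)`: `L(F) G = F * G`. -/
def convOp (F : L1Z) : L1Z →L[ℂ] L1Z := ContinuousLinearMap.mul ℂ L1Z F

/-- The probabilities on `ℤ⁺ = {0, 1, 2, …}`, as elements of `L¹(ℤ)`: the nonnegative (in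
particular real-valued) functions of total mass `1` supported in `ℤ⁺`. -/
def probZPlus : Set L1Z :=
  {F | (∀ k : ℤ, 0 ≤ F k) ∧ ∑' k : ℤ, F k = 1 ∧ Function.support (F : ℤ → ℂ) ⊆ {k | 0 ≤ k}}

/-- `A` is power-bounded: `sup_{n ≥ 1} ‖A ^ n‖ < ∞`. -/
def IsPowerBounded {B : Type*} [NormedRing B] (A : B) : Prop :=
  ∃ C : ℝ, ∀ n : ℕ, 1 ≤ n → ‖A ^ n‖ ≤ C

/-- A bounded operator `S` is a Ritt operator if it is power-bounded and
`sup_{n ≥ 1} n ‖S ^ n - S ^ (n + 1)‖ < ∞`. -/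
def IsRitt {X : Type*} [NormedAddCommGroup X] [NormedSpace ℂ X] (S : X →L[ℂ] X) : Prop :=
  IsPowerBounded S ∧ ∃ C : ℝ, ∀ n : ℕ, 1 ≤ n → n * ‖S ^ n - S ^ (n + 1)‖ ≤ C

/-- The class `𝒜` of probabilities `F` on `ℤ⁺` with
`sup_{n ≥ 1} n ‖F ^ n - F ^ (n + 1)‖₁ < ∞`, the powers being convolution powers. -/
def classA : Set L1Z :=
  {F | F ∈ probZPlus ∧ ∃ C : ℝ, ∀ n : ℕ, 1 ≤ n → n * ‖F ^ n - F ^ (n + 1)‖ ≤ C}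

/-- `Ψ(F; T) = ∑_{k ≥ 0} F(k) T ^ k`, used for `T` power-bounded, where the series converges
absolutely in operator norm. -/
def Psi (F : L1Z) {X : Type*} [NormedAddCommGroup X] [NormedSpace ℂ X] (T : X →L[ℂ] X) :
    X →L[ℂ] X :=
  ∑' k : ℕ, F (k : ℤ) • T ^ k

/-- The Fourier transform `F̂(ξ) = ∑_{k ∈ ℤ} F(k) e^{-ikξ}`. -/
def fourierZ (F : L1Z) (ξ : ℝ) : ℂ :=
  ∑' k : ℤ, F k * Complex.exp (-Complex.I * k * ξ)

/-- The generating function `φ_F(w) = ∑_{k ≥ 0} F(k) w ^ k`, used for `|w| ≤ 1`. -/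
def genFun (F : L1Z) (w : ℂ) : ℂ := ∑' k : ℕ, F (k : ℤ) * w ^ k

/-- `𝔻 ∪ {1}`: the open unit disc together with the point `1`. -/
def discOne : Set ℂ := Metric.ball 0 1 ∪ {1}

/-- The closed sector `{0} ∪ {z : |Arg z| ≤ θ}`. -/
def closedSector (θ : ℝ) : Set ℂ := {0} ∪ {z | |z.arg| ≤ θ}

end RittProb

end

noncomputable section

namespace RittProb

/-! The hard implication is from the semigroup condition to the discrete estimate. Applying the
bound on `(1 - F) e^{-t(1-F)}` at time `t / n` and taking `n`-th powers controls the Taylor series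
in the angle, so the semigroup stays bounded when its generator is multiplied by `1 ± iκ` with `κ`
small. Its Laplace transform then bounds `(1 - zF)⁻¹` by `K / |1 - z|` near `z = 1`. Away from `1`
compactness suffices: the characters of `L¹(ℤ)` evaluate `φ_F` on the unit circle, and the Fourier
condition makes `1 - zF` invertible for `|z| = 1`, `z ≠ 1`. Cauchy's estimate for `(1 - F)(1 -
zF)⁻³` turns this resolvent bound into `‖F^n - F^(n+1)‖ = O(1/n)`
(`exists_norm_inverse_one_sub_smul_le`, `exists_ritt_bound_of_norm_inverse_le`). Conversely, the
semigroup is a Poisson average of the powers of `F`.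

The operator conditions are formal: `L` is isometric and multiplicative, `F ↦ Ψ(F; T)` is bounded
and multiplicative on elements supported in `ℤ⁺`, and `T = L(δ₁)` gives `Ψ(F; T) = L(F)`.

For scalars, the same calculus gives a uniform Ritt bound for `φ_F(w)`, hence a sector. A finite
first moment `m` would make `φ_F(e^{it})` leave `1` in the direction `i m`, tangent to the circle;
the sector forbids this unless `m = 0`. -/

lemma norm_pow_le_one {A : Type*} [NormedRing A] [NormOneClass A] {a : A} (ha : ‖a‖ ≤ 1) (n : ℕ) : ‖a ^ n‖ ≤ 1 :=
  (norm_pow_le a n).trans (pow_le_one₀ (norm_nonneg _) ha)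

/-! ### Contraction semigroups `e^{-t(1-a)}` and their rotations. -/

section BanachAlgebra

variable {A : Type*} [NormedRing A] [NormedAlgebra ℂ A] [CompleteSpace A]

/-- The exponential series of `-t (1 - a)`, written as a Poisson mixture of the powers of `a`. -/
lemma hasSum_poisson_pow (a : A) (t : ℝ) :
    HasSum (fun k : ℕ => ((Real.exp (-t) * (t ^ k / k.factorial) : ℝ) : ℂ) • a ^ k)
      (NormedSpace.exp (-(t : ℂ) • (1 - a))) := by
  let _ := NormedAlgebra.restrictScalars ℚ ℂ A
  have h1 : NormedSpace.exp (-(t : ℂ) • (1 - a)) =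
      Complex.exp (-t) • NormedSpace.exp ((t : ℂ) • a) := by
    have h2 : -(t : ℂ) • (1 - a) = algebraMap ℂ A (-t) + (t : ℂ) • a := by
      rw [Algebra.algebraMap_eq_smul_one, smul_sub]
      simp only [neg_smul]
      abel
    rw [h2, NormedSpace.exp_add_of_commute (Algebra.commutes _ _),
      ← NormedSpace.algebraMap_exp_comm, ← Complex.exp_eq_exp_ℂ, ← Algebra.smul_def]
  rw [h1]
  have h3 := (NormedSpace.exp_series_hasSum_exp' (𝕂 := ℂ) ((t : ℂ) • a)).const_smul
    (Complex.exp (-t))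
  convert! h3 using 2 with k
  rw [smul_pow, smul_smul, smul_smul]
  congr 1
  push_cast
  ring

lemma hasSum_poisson_weights (t : ℝ) :
    HasSum (fun k : ℕ => Real.exp (-t) * (t ^ k / k.factorial)) 1 := by
  have h := (NormedSpace.expSeries_div_hasSum_exp t).mul_left (Real.exp (-t))
  rwa [← Real.exp_eq_exp_ℝ, ← Real.exp_add, neg_add_cancel, Real.exp_zero] at h

lemma norm_exp_neg_smul_le_one [NormOneClass A] {a : A} (ha : ‖a‖ ≤ 1) {t : ℝ} (ht : 0 ≤ t) :
    ‖NormedSpace.exp (-(t : ℂ) • (1 - a))‖ ≤ 1 := by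
  rw [← (hasSum_poisson_pow a t).tsum_eq]
  refine tsum_of_norm_bounded (hasSum_poisson_weights t) fun k => ?_
  rw [norm_smul, Complex.norm_real, Real.norm_of_nonneg (by positivity)]
  exact mul_le_of_le_one_right (by positivity) (norm_pow_le_one ha k)

/-- The discrete Ritt estimate passes to the continuous semigroup `e^{-t(1 - a)}`. -/
lemma norm_one_sub_mul_exp_le_of_ritt [NormOneClass A] {a : A} (ha : ‖a‖ ≤ 1) {C : ℝ}
    (hC : ∀ n : ℕ, 1 ≤ n → n * ‖a ^ n - a ^ (n + 1)‖ ≤ C) {t : ℝ} (ht : 0 ≤ t) :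
    t * ‖(1 - a) * NormedSpace.exp (-(t : ℂ) • (1 - a))‖ ≤ 2 * C + 2 := by
  have hC0 : 0 ≤ C := le_trans (by positivity) (hC 1 le_rfl)
  -- The extra copy of the difference in `k + 1`, and the case `k = 0`, are absorbed by the trivial
  -- bound `2`.
  have hD : ∀ k : ℕ, ((k : ℝ) + 1) * ‖(1 - a) * a ^ k‖ ≤ 2 * C + 2 := by
    intro k
    have hk : (1 - a) * a ^ k = a ^ k - a ^ (k + 1) := by rw [sub_mul, one_mul, pow_succ']
    rw [hk]
    have h2 : ‖a ^ k - a ^ (k + 1)‖ ≤ 2 := by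
      refine (norm_sub_le _ _).trans ?_
      linarith [norm_pow_le_one ha k, norm_pow_le_one ha (k + 1)]
    rcases Nat.eq_zero_or_pos k with rfl | hk0
    · simp at h2 ⊢
      linarith
    · have := hC k hk0
      linarith
  have h1 := ((hasSum_poisson_pow a t).mul_left (1 - a)).const_smul (t : ℂ)
  have h2 : t * ‖(1 - a) * NormedSpace.exp (-(t : ℂ) • (1 - a))‖ =
      ‖(t : ℂ) • ((1 - a) * NormedSpace.exp (-(t : ℂ) • (1 - a)))‖ := by
    rw [norm_smul, Complex.norm_real, Real.norm_of_nonneg ht]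
  rw [h2, ← h1.tsum_eq]
  -- The Poisson weights satisfy `t p_k = (k + 1) p_{k+1}`, so the factor `t` becomes the Ritt
  -- factor; the shifted weights sum to `1 - e^{-t} ≤ 1`.
  have hw := ((hasSum_nat_add_iff' 1).2 (hasSum_poisson_weights t)).mul_right (2 * C + 2)
  refine (tsum_of_norm_bounded hw fun k => ?_).trans ?_
  · rw [mul_smul_comm, norm_smul, norm_smul, Complex.norm_real, Complex.norm_real,
      Real.norm_of_nonneg ht, Real.norm_of_nonneg (by positivity)]
    have h3 : t * (Real.exp (-t) * (t ^ k / k.factorial) * ‖(1 - a) * a ^ k‖) =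
        Real.exp (-t) * (t ^ (k + 1) / (k + 1).factorial) *
          (((k : ℝ) + 1) * ‖(1 - a) * a ^ k‖) := by
      rw [Nat.factorial_succ]
      push_cast
      field_simp
      ring
    rw [h3]
    exact mul_le_mul_of_nonneg_left (hD k) (by positivity)
  · refine mul_le_of_le_one_left (by positivity) ?_
    simp
    positivity

/-- A semigroup bound `M` for `e^{-tb}` bounds the resolvent of `-b` at `z` by `M / Re z`. -/
lemma norm_resolvent_le_of_norm_exp_le {b S : A} {M : ℝ}
    (hM : ∀ t : ℝ, 0 ≤ t → ‖NormedSpace.exp (-(t : ℂ) • b)‖ ≤ M) {z : ℂ} (hz : 0 < z.re)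
    (hS : (algebraMap ℂ A z + b) * S = 1) : ‖S‖ ≤ M / z.re := by
  let _ := NormedAlgebra.restrictScalars ℚ ℂ A
  set d : A := -(algebraMap ℂ A z + b) with hd
  have hM0 : 0 ≤ M := (norm_nonneg _).trans (hM 0 le_rfl)
  have hexp : ∀ t : ℝ, 0 ≤ t → ‖NormedSpace.exp ((t : ℂ) • d)‖ ≤ M * Real.exp (-z.re * t) := by
    intro t ht
    have h1 : (t : ℂ) • d = algebraMap ℂ A (-(t * z)) + -(t : ℂ) • b := by
      rw [hd, Algebra.algebraMap_eq_smul_one, Algebra.algebraMap_eq_smul_one, smul_neg, smul_add,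
        smul_smul, neg_smul, neg_smul, neg_add]
    rw [h1, NormedSpace.exp_add_of_commute (Algebra.commutes _ _),
      ← NormedSpace.algebraMap_exp_comm, ← Complex.exp_eq_exp_ℂ, ← Algebra.smul_def, norm_smul,
      Complex.norm_exp, mul_comm]
    have h2 : (-((t : ℂ) * z)).re = -z.re * t := by simp [mul_comm]
    rw [h2]
    exact mul_le_mul_of_nonneg_right (hM t ht) (by positivity)
  -- Since `d * S = -1`, this function is minus the integral of `e^{ud}` over `[0, t]`. A mean value
  -- inequality against the primitive of `M e^{-t Re z}` replaces the Laplace integral.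
  have hder : ∀ t : ℝ, HasDerivAt (fun u : ℝ => NormedSpace.exp ((u : ℂ) • d) * S - S)
      (-NormedSpace.exp ((t : ℂ) • d)) t := by
    intro t
    have h1 : HasDerivAt (fun u : ℝ => NormedSpace.exp ((u : ℂ) • d) * S - S)
        (NormedSpace.exp ((t : ℂ) • d) * d * S) t := by
      let _ := NormedAlgebra.restrictScalars ℝ ℂ A
      have h0 : HasDerivAt (fun u : ℝ => NormedSpace.exp ((u : ℂ) • d))
          (NormedSpace.exp ((t : ℂ) • d) * d) t := by
        have := (hasDerivAt_exp_smul_const (𝕂 := ℂ) d (t : ℂ)).scomp t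
          Complex.ofRealCLM.hasDerivAt
        simpa [Function.comp_def] using this
      exact (h0.mul_const S).sub_const S
    have h2 : NormedSpace.exp ((t : ℂ) • d) * d * S = -NormedSpace.exp ((t : ℂ) • d) := by
      rw [mul_assoc, hd, neg_mul, hS]
      simp
    rwa [h2] at h1
  have hB : ∀ t : ℝ, HasDerivAt (fun u : ℝ => M / z.re * (1 - Real.exp (-z.re * u)))
      (M * Real.exp (-z.re * t)) t := by
    intro t
    have h1 := ((((hasDerivAt_id t).const_mul (-z.re)).exp).const_sub 1).const_mul (M / z.re)
    refine h1.congr_deriv ?_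
    simp only [id]
    field_simp
  have hmv : ∀ T : ℝ, 0 ≤ T → ‖S‖ ≤ M / z.re + M * Real.exp (-z.re * T) * ‖S‖ := by
    intro T hT
    have h1 := image_norm_le_of_norm_deriv_right_le_deriv_boundary (a := 0) (b := T)
      (f := fun u : ℝ => NormedSpace.exp ((u : ℂ) • d) * S - S)
      (f' := fun t : ℝ => -NormedSpace.exp ((t : ℂ) • d))
      (fun t _ => (hder t).continuousAt.continuousWithinAt)
      (fun t _ => (hder t).hasDerivWithinAt) (by simp) hB
      (fun t ht => by rw [norm_neg]; exact hexp t ht.1) (Set.right_mem_Icc.2 hT)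
    have h2 : ‖NormedSpace.exp ((T : ℂ) • d) * S‖ ≤ M * Real.exp (-z.re * T) * ‖S‖ :=
      (norm_mul_le _ _).trans (mul_le_mul_of_nonneg_right (hexp T hT) (norm_nonneg _))
    have h3 : ‖S‖ ≤ ‖NormedSpace.exp ((T : ℂ) • d) * S - S‖ + ‖NormedSpace.exp ((T : ℂ) • d) * S‖ := by
      have := norm_sub_le (NormedSpace.exp ((T : ℂ) • d) * S)
        (NormedSpace.exp ((T : ℂ) • d) * S - S)
      rw [sub_sub_cancel] at this
      linarith
    have h4 : M / z.re * (1 - Real.exp (-z.re * T)) ≤ M / z.re := by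
      have : 0 ≤ M / z.re * Real.exp (-z.re * T) := by positivity
      linarith
    linarith
  have hlim : Filter.Tendsto (fun T : ℝ => M / z.re + M * Real.exp (-z.re * T) * ‖S‖)
      Filter.atTop (nhds (M / z.re + M * 0 * ‖S‖)) := by
    refine tendsto_const_nhds.add ((Filter.Tendsto.const_mul M ?_).mul_const _)
    refine Real.tendsto_exp_atBot.comp ?_
    exact Filter.tendsto_id.const_mul_atTop_of_neg (by linarith)
  have := ge_of_tendsto hlim (Filter.eventually_atTop.2 ⟨0, hmv⟩)
  simpa using this

/-- Boundedness of the rotated semigroup `e^{-t(1 + iκ)(1 - a)}` for small `κ`. -/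
lemma norm_exp_rotated_le [NormOneClass A] {a : A} (ha : ‖a‖ ≤ 1) {C : ℝ}
    (hC : ∀ t : ℝ, 0 ≤ t → t * ‖(1 - a) * NormedSpace.exp (-(t : ℂ) • (1 - a))‖ ≤ C)
    {κ : ℝ} (hκ : |κ| * (C * Real.exp 1) ≤ 1 / 2) {t : ℝ} (ht : 0 ≤ t) :
    ‖NormedSpace.exp (-(t : ℂ) • ((1 + κ * Complex.I) • (1 - a)))‖ ≤ 2 := by
  let _ := NormedAlgebra.restrictScalars ℚ ℂ A
  have hC0 : 0 ≤ C := le_trans (by positivity) (hC 1 zero_le_one)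
  set E := NormedSpace.exp (-(t : ℂ) • (1 - a)) with hE
  have hsplit : -(t : ℂ) • ((1 + κ * Complex.I) • (1 - a)) =
      (-(t * κ * Complex.I)) • (1 - a) + -(t : ℂ) • (1 - a) := by
    rw [smul_smul, ← add_smul]
    congr 1
    ring
  have hcomm : Commute ((-(t * κ * Complex.I)) • (1 - a)) (-(t : ℂ) • (1 - a)) :=
    ((Commute.refl (1 - a)).smul_left _).smul_right _
  rw [hsplit, NormedSpace.exp_add_of_commute hcomm]
  have hs := (NormedSpace.exp_series_hasSum_exp' (𝕂 := ℂ)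
    ((-(t * κ * Complex.I)) • (1 - a))).mul_right E
  rw [← hs.tsum_eq]
  -- The `n`-th Taylor term in the angle is at most `(1/2)^n`; summing gives the bound `2`.
  refine tsum_of_norm_bounded hasSum_geometric_two fun n => ?_
  rcases Nat.eq_zero_or_pos n with rfl | hn
  · have h := norm_exp_neg_smul_le_one ha ht
    rw [← hE] at h
    simpa using h
  have hn' : (0 : ℝ) < n := by exact_mod_cast hn
  have hpow : (1 - a) ^ n * E =
      ((1 - a) * NormedSpace.exp (-((t / n : ℝ) : ℂ) • (1 - a))) ^ n := by
    have hc : Commute (1 - a) (NormedSpace.exp (-((t / n : ℝ) : ℂ) • (1 - a))) :=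
      Commute.exp_right ((Commute.refl _).smul_right _)
    rw [hc.mul_pow, ← NormedSpace.exp_nsmul, ← Nat.cast_smul_eq_nsmul ℂ, smul_smul, hE]
    congr 4
    push_cast
    field_simp
  have hbound : ‖(1 - a) ^ n * E‖ * t ^ n ≤ (C * n) ^ n := by
    rw [hpow]
    refine (mul_le_mul_of_nonneg_right (norm_pow_le' _ hn) (by positivity)).trans ?_
    rw [← mul_pow]
    refine pow_le_pow_left₀ (by positivity) ?_ n
    have := hC (t / n) (by positivity)
    rw [div_mul_eq_mul_div, div_le_iff₀ hn'] at this
    linarith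
  rw [smul_pow, smul_mul_assoc, smul_mul_assoc, norm_smul, norm_smul]
  have h1 : ‖((n.factorial : ℂ)⁻¹)‖ = (n.factorial : ℝ)⁻¹ := by simp
  have h2 : ‖(-(t * κ * Complex.I)) ^ n‖ = t ^ n * |κ| ^ n := by
    simp [abs_of_nonneg ht, mul_pow]
  rw [h1, h2]
  -- The factor `e` in the smallness condition on `κ` comes from `n^n / n! ≤ e^n`.
  have hfac : (n : ℝ) ^ n / n.factorial ≤ Real.exp 1 ^ n := by
    rw [← Real.exp_nat_mul, mul_one]
    exact Real.pow_div_factorial_le_exp (n : ℝ) hn'.le n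
  calc (n.factorial : ℝ)⁻¹ * (t ^ n * |κ| ^ n * ‖(1 - a) ^ n * E‖)
      = |κ| ^ n * (‖(1 - a) ^ n * E‖ * t ^ n) / n.factorial := by ring
    _ ≤ |κ| ^ n * (C * n) ^ n / n.factorial := by gcongr
    _ = (|κ| * C) ^ n * ((n : ℝ) ^ n / n.factorial) := by rw [mul_pow, mul_pow]; ring
    _ ≤ (|κ| * C) ^ n * Real.exp 1 ^ n := by gcongr
    _ = (|κ| * (C * Real.exp 1)) ^ n := by rw [← mul_pow]; ring
    _ ≤ (1 / 2) ^ n := pow_le_pow_left₀ (by positivity) hκ n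

end BanachAlgebra

/-! ### Circle means and Cauchy estimates. -/

/-- The mean of `|1 - z|⁻²` over the circle `|z| = r`. -/
lemma circleAverage_inv_norm_one_sub_sq {r : ℝ} (hr0 : 0 ≤ r) (hr1 : r < 1) :
    Real.circleAverage (fun z : ℂ => (‖1 - z‖ ^ 2)⁻¹) 0 r = (1 - r ^ 2)⁻¹ := by
  have hne : ∀ z ∈ Metric.closedBall (0 : ℂ) r, 1 - z ≠ 0 := by
    intro z hz h
    rw [mem_closedBall_zero_iff, ← sub_eq_zero.1 h, norm_one] at hz
    linarith
  have hdiff : DifferentiableOn ℂ (fun z : ℂ => (1 + z) / (1 - z)) (Metric.closedBall 0 r) :=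
    fun z hz => (DifferentiableAt.div (by fun_prop) (by fun_prop) (hne z hz)).differentiableWithinAt
  have hdc : DiffContOnCl ℂ (fun z : ℂ => (1 + z) / (1 - z)) (Metric.ball 0 |r|) := by
    rw [abs_of_nonneg hr0]
    exact (hdiff.mono Metric.closure_ball_subset_closedBall).diffContOnCl
  have hmean := hdc.circleAverage
  have hmem : ∀ θ : ℝ, circleMap 0 r θ ∈ Metric.closedBall (0 : ℂ) r := fun θ =>
    circleMap_mem_closedBall 0 hr0 θ
  have hcont : Continuous fun θ : ℝ => (1 + circleMap 0 r θ) / (1 - circleMap 0 r θ) :=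
    Continuous.div (by fun_prop) (by fun_prop) fun θ => hne _ (hmem θ)
  -- Up to the factor `1 - r²` this is the Poisson kernel, the real part of `(1 + z) / (1 - z)`,
  -- whose mean is its value `1` at the centre.
  have hre : ∀ θ : ℝ, (‖1 - circleMap 0 r θ‖ ^ 2)⁻¹ =
      (1 - r ^ 2)⁻¹ * Complex.reCLM ((1 + circleMap 0 r θ) / (1 - circleMap 0 r θ)) := by
    intro θ
    have hn : ‖circleMap 0 r θ‖ ^ 2 = r ^ 2 := by
      rw [norm_circleMap_zero, sq_abs]
    rw [← Complex.normSq_eq_norm_sq, Complex.normSq_apply] at hn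
    have h0 : Complex.normSq (1 - circleMap 0 r θ) ≠ 0 := by
      simpa [Complex.normSq_eq_zero] using hne _ (hmem θ)
    have h1 : 1 - r ^ 2 ≠ 0 := by nlinarith
    rw [Complex.reCLM_apply, Complex.div_re, ← Complex.normSq_eq_norm_sq]
    field_simp
    simp
    nlinarith
  rw [Real.circleAverage_def] at hmean ⊢
  simp only [hre]
  rw [intervalIntegral.integral_const_mul, ContinuousLinearMap.intervalIntegral_comp_comm _
    (hcont.intervalIntegrable _ _)]
  have h2 := congrArg Complex.re hmean
  simp only [Complex.smul_re, smul_eq_mul] at h2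
  simp only [Complex.reCLM_apply, smul_eq_mul]
  rw [mul_left_comm, h2]
  simp

/-- Cauchy's estimate for the coefficients of a power series, with the mean of the norm. -/
lemma norm_coeff_le_circleAverage {E : Type*} [NormedAddCommGroup E] [NormedSpace ℂ E]
    [CompleteSpace E] {c : ℕ → E} {f : ℂ → E}
    (hf : ∀ z : ℂ, ‖z‖ < 1 → HasSum (fun n => z ^ n • c n) (f z)) {r : ℝ} (hr0 : 0 < r)
    (hr1 : r < 1) (n : ℕ) :
    ‖c n‖ ≤ Real.circleAverage (fun z => ‖f z‖) 0 r * r⁻¹ ^ n := by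
  let p : FormalMultilinearSeries ℂ ℂ E := fun n => ContinuousMultilinearMap.mkPiRing ℂ (Fin n) (c n)
  have hp : ∀ n, ‖p n‖ = ‖c n‖ := fun n => ContinuousMultilinearMap.norm_mkPiRing _
  -- The intermediate radius puts the closed disc of radius `r` inside an open disc of convergence;
  -- uniqueness of power series then identifies `c` with the Cauchy coefficients.
  obtain ⟨s, hrs, hs1⟩ := exists_between hr1
  have hs0 : 0 < s := hr0.trans hrs
  lift s to NNReal using hs0.le
  lift r to NNReal using hr0.le
  have hrad : (s : ℝ≥0∞) ≤ p.radius := by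
    have h1 := (hf (s : ℝ) (by simpa using hs1)).summable.tendsto_atTop_zero.norm
    refine p.le_radius_of_tendsto (l := 0) ?_
    rw [norm_zero] at h1
    refine h1.congr fun n => ?_
    rw [norm_smul, norm_pow, hp, mul_comm]
    simp
  have hps : HasFPowerSeriesOnBall f p 0 s :=
    { r_le := hrad
      r_pos := by exact_mod_cast hs0
      hasSum := by
        intro z hz
        have hz1 : ‖z‖ < 1 := by
          have : z ∈ Metric.ball (0 : ℂ) s := by simpa using hz
          rw [mem_ball_zero_iff] at this
          linarith
        simpa [p] using hf z hz1 }
  have hdiff : DifferentiableOn ℂ f (Metric.closedBall 0 r) := by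
    refine hps.differentiableOn.mono fun z hz => ?_
    have h1 : z ∈ Metric.ball (0 : ℂ) s :=
      Metric.closedBall_subset_ball (by exact_mod_cast hrs) hz
    simpa using h1
  have hcauchy := hdiff.hasFPowerSeriesOnBall (by exact_mod_cast hr0)
  have heq := hps.hasFPowerSeriesAt.eq_formalMultilinearSeries hcauchy.hasFPowerSeriesAt
  have hle := norm_cauchyPowerSeries_le f 0 r n
  rw [← heq, hp, NNReal.abs_eq] at hle
  exact hle

/-! ### From the semigroup to the resolvent, and from the resolvent to powers. -/

section Resolvent

variable {A : Type*} [NormedRing A] [NormedAlgebra ℂ A] [CompleteSpace A]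

lemma isUnit_one_sub_smul [NormOneClass A] {a : A} (ha : ‖a‖ ≤ 1) {z : ℂ} (hz : ‖z‖ < 1) :
    IsUnit (1 - z • a) := by
  refine isUnit_one_sub_of_norm_lt_one ?_
  rw [norm_smul]
  nlinarith [norm_nonneg z, norm_nonneg a]

/-- Bounded analyticity of `e^{-t(1 - a)}` and the spectral condition on the circle give the
resolvent condition of Ritt's type on the open disc. -/
lemma exists_norm_inverse_one_sub_smul_le [NormOneClass A] {a : A} (ha : ‖a‖ ≤ 1)
    (hunit : ∀ z : ℂ, ‖z‖ = 1 → z ≠ 1 → IsUnit (1 - z • a)) {C : ℝ}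
    (hC : ∀ t : ℝ, 0 ≤ t → t * ‖(1 - a) * NormedSpace.exp (-(t : ℂ) • (1 - a))‖ ≤ C) :
    ∃ K : ℝ, 0 ≤ K ∧ ∀ z : ℂ, ‖z‖ < 1 → ‖Ring.inverse (1 - z • a)‖ ≤ K / ‖1 - z‖ := by
  have hC0 : 0 ≤ C := le_trans (by positivity) (hC 1 zero_le_one)
  -- The last condition is what `norm_exp_rotated_le` requires; `κ ≤ 1` keeps `|1 ± iκ| ≤ 2`.
  obtain ⟨κ, hκ0, hκ1, hκC⟩ : ∃ κ : ℝ, 0 < κ ∧ κ ≤ 1 ∧ κ * (C * Real.exp 1) ≤ 1 / 2 := by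
    refine ⟨1 / (2 * (C * Real.exp 1 + 1)), by positivity, ?_, ?_⟩
    · rw [div_le_one (by positivity)]
      have : 0 ≤ C * Real.exp 1 := by positivity
      linarith
    · rw [div_mul_eq_mul_div, div_le_div_iff₀ (by positivity) (by positivity)]
      have : 0 ≤ C * Real.exp 1 := by positivity
      linarith
  obtain ⟨B, hB⟩ : ∃ B : ℝ, ∀ z : ℂ, ‖z‖ ≤ 1 → κ / 4 ≤ ‖1 - z‖ →
      ‖Ring.inverse (1 - z • a)‖ ≤ B := by
    have hcomp : IsCompact (Metric.closedBall (0 : ℂ) 1 ∩ {z | κ / 4 ≤ ‖1 - z‖}) :=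
      (isCompact_closedBall _ _).inter_right
        (isClosed_le continuous_const (by fun_prop))
    have hcont : ContinuousOn (fun z : ℂ => Ring.inverse (1 - z • a))
        (Metric.closedBall (0 : ℂ) 1 ∩ {z | κ / 4 ≤ ‖1 - z‖}) := by
      intro z hz
      have hu : IsUnit (1 - z • a) := by
        rcases (mem_closedBall_zero_iff.1 hz.1).lt_or_eq with h | h
        · exact isUnit_one_sub_smul ha h
        · refine hunit z h ?_
          rintro rfl
          have h2 : κ / 4 ≤ ‖(1 : ℂ) - 1‖ := hz.2
          rw [sub_self, norm_zero] at h2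
          linarith
      obtain ⟨u, hu⟩ := hu
      have h1 := NormedRing.inverse_continuousAt u
      rw [hu] at h1
      exact (ContinuousAt.comp (f := fun z : ℂ => 1 - z • a) h1 (by fun_prop)).continuousWithinAt
    obtain ⟨B, hB⟩ := hcomp.exists_bound_of_continuousOn hcont
    exact ⟨B, fun z h1 h2 => hB z ⟨by simpa using h1, h2⟩⟩
  have hB0 : 0 ≤ B := (norm_nonneg _).trans (hB 0 (by simp) (by simp; linarith))
  refine ⟨2 * B + 16 / κ, by positivity, fun z hz => ?_⟩
  have hz1 : 0 < ‖1 - z‖ := by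
    rw [norm_pos_iff, sub_ne_zero]
    rintro rfl
    simp at hz
  rcases le_or_gt (κ / 4) ‖1 - z‖ with hfar | hnear
  · refine (hB z hz.le hfar).trans ?_
    rw [le_div_iff₀ hz1]
    have h2 : ‖1 - z‖ ≤ 2 := (norm_sub_le _ _).trans (by rw [norm_one]; linarith)
    have h3 : 0 ≤ 16 / κ := by positivity
    nlinarith
  have hzhalf : 1 / 2 ≤ ‖z‖ := by
    have := norm_sub_norm_le (1 : ℂ) z
    rw [norm_one] at this
    linarith
  have hz0 : z ≠ 0 := by
    rintro rfl
    norm_num at hzhalf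
  -- With this `l`, `1 - z a = z (l + (1 - a))`, so the inverse sought is a resolvent of the
  -- semigroup generator `-(1 - a)`.
  set l : ℂ := (1 - z) / z with hl
  have hzl : ‖l‖ * ‖z‖ = ‖1 - z‖ := by
    rw [hl, norm_div, div_mul_cancel₀ _ (by simpa using hz0)]
  have hl0 : 0 < ‖l‖ := by
    by_contra h
    have : ‖l‖ = 0 := le_antisymm (not_lt.1 h) (norm_nonneg _)
    rw [this] at hzl
    linarith
  have hlsmall : ‖l‖ ≤ κ / 2 := by nlinarith
  have hlge : ‖1 - z‖ ≤ ‖l‖ := by nlinarith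
  -- `|z| < 1` means `|1 + l| > 1`: the real part of `l` may be negative, but only to second order
  -- in `|l|`.
  have hlre : 0 < 2 * l.re + ‖l‖ ^ 2 := by
    have h1 : (1 + l) * z = 1 := by
      rw [hl]
      field_simp
      ring
    have h2 : ‖1 + l‖ * ‖z‖ = 1 := by rw [← norm_mul, h1, norm_one]
    have h3 : 1 < ‖1 + l‖ := by nlinarith [norm_nonneg (1 + l)]
    have h4 : 1 < ‖1 + l‖ ^ 2 := by nlinarith
    rw [← Complex.normSq_eq_norm_sq, Complex.normSq_apply] at h4 ⊢
    simp at h4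
    nlinarith
  have hdir : κ / 2 * ‖l‖ ≤ l.re + κ * |l.im| := by
    have h1 := Complex.norm_le_abs_re_add_abs_im l
    rcases le_or_gt 0 l.re with h | h
    · rw [abs_of_nonneg h] at h1
      nlinarith [abs_nonneg l.im]
    · rw [abs_of_neg h] at h1
      nlinarith [abs_nonneg l.im]
  -- Rotating against the sign of `Im l` makes `Re ((1 + iσ) l) = Re l + κ |Im l|`, which `hdir`
  -- bounds below by a multiple of `|l|`.
  obtain ⟨σ, hσ, hσl⟩ : ∃ σ : ℝ, |σ| = κ ∧ l.re - σ * l.im = l.re + κ * |l.im| := by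
    rcases le_or_gt 0 l.im with h | h
    · exact ⟨-κ, by rw [abs_neg, abs_of_pos hκ0], by rw [abs_of_nonneg h]; ring⟩
    · exact ⟨κ, abs_of_pos hκ0, by rw [abs_of_neg h]; ring⟩
  set c : ℂ := 1 + σ * Complex.I with hc
  have hc0 : c ≠ 0 := by
    intro h
    have := congrArg Complex.re h
    simp [hc] at this
  have hcnorm : ‖c‖ ≤ 2 := by
    refine (norm_add_le _ _).trans ?_
    simp [hσ]
    linarith
  have hre : (c * l).re = l.re + κ * |l.im| := by
    rw [← hσl]
    simp [hc]
  have hrepos : 0 < (c * l).re := by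
    rw [hre]
    exact lt_of_lt_of_le (by positivity) hdir
  set S := Ring.inverse (1 - z • a) with hS
  have hSinv : (1 - z • a) * S = 1 := Ring.mul_inverse_cancel _ (isUnit_one_sub_smul ha hz)
  have hres : (algebraMap ℂ A (c * l) + c • (1 - a)) * ((c⁻¹ * z) • S) = 1 := by
    have h1 : algebraMap ℂ A (c * l) + c • (1 - a) = (c * z⁻¹) • (1 - z • a) := by
      rw [Algebra.algebraMap_eq_smul_one, smul_sub, smul_sub, smul_smul, ← add_sub_assoc,
        ← add_smul]
      congr 2
      · rw [hl]
        field_simp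
        ring
      · field_simp
    rw [h1, smul_mul_smul_comm, hSinv]
    have : c * z⁻¹ * (c⁻¹ * z) = 1 := by field_simp
    rw [this, one_smul]
  have hbound := norm_resolvent_le_of_norm_exp_le (M := 2)
    (fun t ht => norm_exp_rotated_le ha hC (κ := σ) (by rw [hσ]; exact hκC) ht) hrepos hres
  have h5 : ‖S‖ ≤ 4 * ‖(c⁻¹ * z) • S‖ := by
    rw [norm_smul, norm_mul, norm_inv]
    have h6 : 1 / 2 ≤ ‖c‖⁻¹ := by
      rw [one_div]
      exact inv_anti₀ (norm_pos_iff.2 hc0) hcnorm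
    have h7 : 1 / 4 ≤ ‖c‖⁻¹ * ‖z‖ := by nlinarith
    nlinarith [norm_nonneg S]
  have h8 : 2 / (c * l).re ≤ 4 / (κ * ‖1 - z‖) := by
    rw [hre, div_le_div_iff₀ (by rw [← hre]; exact hrepos) (by positivity)]
    nlinarith
  calc ‖S‖ ≤ 4 * (4 / (κ * ‖1 - z‖)) := h5.trans (by linarith)
    _ = 16 / κ / ‖1 - z‖ := by
      field_simp
      norm_num
    _ ≤ (2 * B + 16 / κ) / ‖1 - z‖ := by gcongr; linarith

/-- The resolvent condition of Ritt's type on the open disc implies the Ritt estimate. -/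
lemma exists_ritt_bound_of_norm_inverse_le [NormOneClass A] {a : A} (ha : ‖a‖ ≤ 1) {K : ℝ}
    (hK0 : 0 ≤ K)
    (hK : ∀ z : ℂ, ‖z‖ < 1 → ‖Ring.inverse (1 - z • a)‖ ≤ K / ‖1 - z‖) :
    ∃ C : ℝ, ∀ n : ℕ, 1 ≤ n → n * ‖a ^ n - a ^ (n + 1)‖ ≤ C := by
  -- Here `12 = 2 · 3 · 2`: from `1 / r ≤ 2`, from `r⁻ⁿ ≤ 3`, and from the denominator of the
  -- binomial coefficient.
  refine ⟨12 * ((1 + K) * K ^ 2), fun n hn => ?_⟩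
  have hn0 : (1 : ℝ) ≤ n := by exact_mod_cast hn
  -- One resolvent is cancelled by `1 - a`, leaving `|1 - z|⁻²`, whose mean grows like `n` against
  -- coefficients of order `n²`. With a square instead of a cube, the mean of `|1 - z|⁻¹` would cost
  -- a logarithm.
  set f : ℂ → A := fun z => (1 - a) * Ring.inverse (1 - z • a) ^ 3 with hf
  have hsum : ∀ z : ℂ, ‖z‖ < 1 →
      HasSum (fun n : ℕ => z ^ n • ((1 - a) * (((n + 2).choose 2 : A) * a ^ n))) (f z) := by
    intro z hz
    have hza : ‖z • a‖ < 1 := by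
      rw [norm_smul]
      nlinarith [norm_nonneg z, norm_nonneg a]
    have h := (hasSum_choose_mul_geometric_of_norm_lt_one' 2 hza).mul_left (1 - a)
    convert! h using 2 with n
    rw [smul_pow, mul_smul_comm, mul_smul_comm]
  -- This makes `1 - r = 1 / (n + 1)` while `r⁻ⁿ = (1 + 1/n)^n ≤ e`.
  set r : ℝ := n / (n + 1) with hr
  have hr0 : 0 < r := by positivity
  have hr1 : r < 1 := by rw [hr, div_lt_one (by positivity)]; linarith
  have hrhalf : 1 / 2 ≤ r := by
    rw [hr, div_le_div_iff₀ (by norm_num) (by positivity)]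
    linarith
  have hcoef := norm_coeff_le_circleAverage hsum hr0 hr1 n
  have hfle : ∀ z ∈ Metric.sphere (0 : ℂ) |r|,
      ‖f z‖ ≤ 2 * ((1 + K) * K ^ 2) * (‖1 - z‖ ^ 2)⁻¹ := by
    intro z hz
    rw [mem_sphere_zero_iff_norm, abs_of_pos hr0] at hz
    have hz1 : ‖z‖ < 1 := hz ▸ hr1
    have h1z : 0 < ‖1 - z‖ := by
      rw [norm_pos_iff, sub_ne_zero]
      rintro rfl
      simp at hz1
    set S := Ring.inverse (1 - z • a) with hS
    have hSinv : (1 - z • a) * S = 1 := Ring.mul_inverse_cancel _ (isUnit_one_sub_smul ha hz1)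
    have hSK := hK z hz1
    have h2 : z • ((1 - a) * S) = 1 - (1 - z) • S := by
      have : (1 - z) • S + z • ((1 - a) * S) = (1 - z • a) * S := by
        rw [sub_mul, sub_mul, one_mul, smul_sub, sub_smul, one_smul, smul_mul_assoc]
        abel
      rw [eq_sub_iff_add_eq', this, hSinv]
    have h3 : ‖z‖ * ‖(1 - a) * S‖ ≤ 1 + K := by
      rw [← norm_smul, h2]
      refine (norm_sub_le _ _).trans ?_
      rw [norm_one, norm_smul]
      have := (le_div_iff₀ h1z).1 hSK
      linarith
    have h4 : ‖(1 - a) * S‖ ≤ 2 * (1 + K) := by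
      rw [hz] at h3
      nlinarith [norm_nonneg ((1 - a) * S)]
    have h5 : f z = ((1 - a) * S) * S ^ 2 := by
      simp only [hf]
      rw [← hS, mul_assoc, ← pow_succ']
    have h6 : ‖S ^ 2‖ ≤ (K / ‖1 - z‖) ^ 2 :=
      (norm_pow_le' _ (by norm_num)).trans (pow_le_pow_left₀ (norm_nonneg _) hSK 2)
    rw [h5]
    calc ‖(1 - a) * S * S ^ 2‖ ≤ ‖(1 - a) * S‖ * ‖S ^ 2‖ := norm_mul_le _ _
      _ ≤ 2 * (1 + K) * (K / ‖1 - z‖) ^ 2 := by gcongr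
      _ = 2 * ((1 + K) * K ^ 2) * (‖1 - z‖ ^ 2)⁻¹ := by
        field_simp
  have hfc : CircleIntegrable (fun z => ‖f z‖) 0 r := by
    refine ContinuousOn.circleIntegrable hr0.le ?_
    intro z hz
    have hz1 : ‖z‖ < 1 := by
      rw [mem_sphere_zero_iff_norm] at hz
      exact hz ▸ hr1
    obtain ⟨u, hu⟩ := isUnit_one_sub_smul ha hz1
    have h1 := NormedRing.inverse_continuousAt u
    rw [hu] at h1
    have h2 : ContinuousAt (fun z : ℂ => Ring.inverse (1 - z • a)) z :=
      ContinuousAt.comp (f := fun z : ℂ => 1 - z • a) h1 (by fun_prop)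
    exact ((h2.pow 3).const_mul (1 - a)).norm.continuousWithinAt
  have hgc : CircleIntegrable (fun z : ℂ => 2 * ((1 + K) * K ^ 2) * (‖1 - z‖ ^ 2)⁻¹) 0 r := by
    refine ContinuousOn.circleIntegrable hr0.le ?_
    intro z hz
    have h1 : ‖1 - z‖ ^ 2 ≠ 0 := by
      refine pow_ne_zero 2 (norm_ne_zero_iff.2 (sub_ne_zero.2 ?_))
      rintro rfl
      rw [mem_sphere_zero_iff_norm, norm_one] at hz
      linarith
    exact ((ContinuousAt.inv₀ (f := fun z : ℂ => ‖1 - z‖ ^ 2) (by fun_prop) h1).const_mul _).continuousWithinAt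
  have havg : Real.circleAverage (fun z => ‖f z‖) 0 r ≤ 2 * ((1 + K) * K ^ 2) * (n + 1) := by
    have h1 := Real.circleAverage_mono hfc hgc hfle
    refine h1.trans ?_
    have h2 : Real.circleAverage (fun z : ℂ => 2 * ((1 + K) * K ^ 2) * (‖1 - z‖ ^ 2)⁻¹) 0 r =
        2 * ((1 + K) * K ^ 2) * Real.circleAverage (fun z : ℂ => (‖1 - z‖ ^ 2)⁻¹) 0 r := by
      simp only [Real.circleAverage_def, smul_eq_mul, intervalIntegral.integral_const_mul]
      ring
    rw [h2, circleAverage_inv_norm_one_sub_sq hr0.le hr1]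
    refine mul_le_mul_of_nonneg_left ?_ (by positivity)
    rw [inv_le_comm₀ (by nlinarith) (by positivity)]
    have h3 : 1 - r = ((n : ℝ) + 1)⁻¹ := by
      rw [hr]
      field_simp
      ring
    rw [← h3]
    nlinarith
  have hrn : r⁻¹ ^ n ≤ 3 := by
    have h1 : r⁻¹ = 1 / (n : ℝ) + 1 := by
      rw [hr]
      field_simp
      ring
    have h2 : r⁻¹ ^ n ≤ Real.exp (1 / n) ^ n := by
      rw [h1]
      exact pow_le_pow_left₀ (by positivity) (Real.add_one_le_exp _) n
    rw [← Real.exp_nat_mul, mul_one_div_cancel (by positivity)] at h2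
    linarith [Real.exp_one_lt_d9]
  have hlhs : (1 - a) * (((n + 2).choose 2 : A) * a ^ n) =
      ((n + 2).choose 2 : ℂ) • (a ^ n - a ^ (n + 1)) := by
    rw [← mul_assoc, ← (Nat.cast_commute ((n + 2).choose 2) (1 - a)).eq, mul_assoc, sub_mul,
      one_mul, ← pow_succ', Nat.cast_smul_eq_nsmul, nsmul_eq_mul]
  rw [hlhs, norm_smul, Complex.norm_natCast, Nat.cast_choose_two] at hcoef
  push_cast at hcoef
  have hfin : ((n : ℝ) + 2) * (n + 2 - 1) / 2 * ‖a ^ n - a ^ (n + 1)‖ ≤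
      2 * ((1 + K) * K ^ 2) * (n + 1) * 3 :=
    hcoef.trans (mul_le_mul havg hrn (by positivity) (by positivity))
  have h9 : ((n : ℝ) + 1) * (n * ‖a ^ n - a ^ (n + 1)‖) ≤
      (n + 1) * (12 * ((1 + K) * K ^ 2)) := by
    nlinarith [norm_nonneg (a ^ n - a ^ (n + 1))]
  exact le_of_mul_le_mul_left h9 (by positivity)

end Resolvent

/-! ### Elements supported in `ℤ⁺` and their power series calculus. -/

namespace L1Z

instance : NormOneClass L1Z where
  norm_one := by
    change ‖(lp.single 1 (0 : ℤ) (1 : ℂ) : L1Z)‖ = 1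
    rw [lp.norm_single (by simp), norm_one]

lemma summable_norm_nat (F : L1Z) : Summable fun k : ℕ => ‖F (k : ℤ)‖ :=
  F.summable_norm.comp_injective Nat.cast_injective

lemma tsum_norm_nat_le (F : L1Z) : ∑' k : ℕ, ‖F (k : ℤ)‖ ≤ ‖F‖ := by
  rw [norm_eq]
  exact tsum_comp_le_tsum_of_inj F.summable_norm (fun _ => norm_nonneg _) Nat.cast_injective

/-- `F` is supported in `{0, 1, 2, …}`. -/
def SuppNonneg (F : L1Z) : Prop := ∀ k : ℤ, k < 0 → F k = 0

lemma SuppNonneg.support_subset_range {F : L1Z} (hF : F.SuppNonneg) {E : Type*}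
    [AddCommMonoid E] {f : ℤ → E} (hf : ∀ k, F k = 0 → f k = 0) :
    Function.support f ⊆ Set.range ((↑) : ℕ → ℤ) := by
  intro k hk
  rcases lt_or_ge k 0 with h | h
  · exact absurd (hf k (hF k h)) hk
  · exact ⟨k.toNat, Int.toNat_of_nonneg h⟩

lemma suppNonneg_one : (1 : L1Z).SuppNonneg := fun k hk => by
  rw [one_apply, if_neg hk.ne]

lemma SuppNonneg.mul {F G : L1Z} (hF : F.SuppNonneg) (hG : G.SuppNonneg) :
    (F * G).SuppNonneg := by
  intro m hm
  rw [mul_apply]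
  convert! tsum_zero with k
  rcases lt_or_ge k 0 with h | h
  · rw [hF k h, zero_mul]
  · rw [hG (m - k) (by omega), mul_zero]

lemma SuppNonneg.pow {F : L1Z} (hF : F.SuppNonneg) (n : ℕ) : (F ^ n).SuppNonneg := by
  induction n with
  | zero => rw [pow_zero]; exact suppNonneg_one
  | succ n ih => rw [pow_succ]; exact ih.mul hF

lemma SuppNonneg.mul_apply_nat {F G : L1Z} (hF : F.SuppNonneg) (hG : G.SuppNonneg) (m : ℕ) :
    (F * G) (m : ℤ) = ∑ k ∈ Finset.range (m + 1), F (k : ℤ) * G ((m - k : ℕ) : ℤ) := by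
  rw [mul_apply, ← Nat.cast_injective.tsum_eq
    (hF.support_subset_range fun k hk => by rw [hk, zero_mul]),
    tsum_eq_sum (s := Finset.range (m + 1))]
  · refine Finset.sum_congr rfl fun k hk => ?_
    rw [Nat.cast_sub (by simpa [Nat.lt_succ_iff] using hk)]
  · intro k hk
    rw [Finset.mem_range] at hk
    rw [hG _ (by omega), mul_zero]

end L1Z

open L1Z

section FunctionalCalculus

variable {B : Type*} [NormedRing B] [NormedAlgebra ℂ B]

/-- The power series `∑_{k ≥ 0} F(k) b ^ k` in a Banach algebra. -/
def powSeries (F : L1Z) (b : B) : B := ∑' k : ℕ, F (k : ℤ) • b ^ k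

lemma summable_norm_powSeries (F : L1Z) {b : B} {M : ℝ} (hb : ∀ k : ℕ, ‖b ^ k‖ ≤ M) :
    Summable fun k : ℕ => ‖F (k : ℤ) • b ^ k‖ := by
  refine Summable.of_nonneg_of_le (fun _ => norm_nonneg _) (fun k => ?_)
    (F.summable_norm_nat.mul_right M)
  rw [norm_smul]
  exact mul_le_mul_of_nonneg_left (hb k) (norm_nonneg _)

lemma norm_powSeries_le (F : L1Z) {b : B} {M : ℝ} (hb : ∀ k : ℕ, ‖b ^ k‖ ≤ M) :
    ‖powSeries F b‖ ≤ ‖F‖ * M := by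
  have hM : 0 ≤ M := (norm_nonneg _).trans (hb 0)
  refine (tsum_of_norm_bounded (F.summable_norm_nat.hasSum.mul_right M) fun k => ?_).trans
    (mul_le_mul_of_nonneg_right F.tsum_norm_nat_le hM)
  rw [norm_smul]
  exact mul_le_mul_of_nonneg_left (hb k) (norm_nonneg _)

lemma powSeries_sub [CompleteSpace B] (F G : L1Z) {b : B} {M : ℝ} (hb : ∀ k : ℕ, ‖b ^ k‖ ≤ M) :
    powSeries (F - G) b = powSeries F b - powSeries G b := by
  rw [powSeries, powSeries, powSeries, ← (summable_norm_powSeries F hb).of_norm.tsum_sub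
    (summable_norm_powSeries G hb).of_norm]
  refine tsum_congr fun k => ?_
  rw [← sub_smul]
  rfl

lemma powSeries_one (b : B) : powSeries 1 b = 1 := by
  rw [powSeries, tsum_eq_single 0]
  · simp [one_apply]
  · intro k hk
    simp [one_apply, hk]

/-- This is the Cauchy product. Both supports must lie in `ℤ⁺`, because `powSeries` discards
negative indices. -/
lemma powSeries_mul [CompleteSpace B] {F G : L1Z} (hF : F.SuppNonneg) (hG : G.SuppNonneg) {b : B} {M : ℝ}
    (hb : ∀ k : ℕ, ‖b ^ k‖ ≤ M) : powSeries (F * G) b = powSeries F b * powSeries G b := by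
  rw [powSeries, powSeries, powSeries, tsum_mul_tsum_eq_tsum_sum_range_of_summable_norm
    (summable_norm_powSeries F hb) (summable_norm_powSeries G hb)]
  refine tsum_congr fun m => ?_
  rw [hF.mul_apply_nat hG, Finset.sum_smul]
  refine Finset.sum_congr rfl fun k hk => ?_
  rw [smul_mul_smul_comm, ← pow_add, Nat.add_sub_cancel' (by simpa [Nat.lt_succ_iff] using hk)]

lemma powSeries_pow [CompleteSpace B] {F : L1Z} (hF : F.SuppNonneg) {b : B} {M : ℝ}
    (hb : ∀ k : ℕ, ‖b ^ k‖ ≤ M) (n : ℕ) : powSeries (F ^ n) b = powSeries F b ^ n := by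
  induction n with
  | zero => rw [pow_zero, pow_zero, powSeries_one]
  | succ n ih => rw [pow_succ, powSeries_mul (hF.pow n) hF hb, ih, pow_succ]

/-- Transfers the Ritt estimate from `F` both to operators and to the scalars `φ_F(w)`. -/
lemma norm_powSeries_pow_sub_le [CompleteSpace B] {F : L1Z} (hF : F.SuppNonneg) {b : B} {M : ℝ}
    (hb : ∀ k : ℕ, ‖b ^ k‖ ≤ M) (n : ℕ) :
    ‖powSeries F b ^ n - powSeries F b ^ (n + 1)‖ ≤ ‖F ^ n - F ^ (n + 1)‖ * M := by
  rw [← powSeries_pow hF hb, ← powSeries_pow hF hb, ← powSeries_sub _ _ hb]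
  exact norm_powSeries_le _ hb

end FunctionalCalculus

namespace L1Z

/-- The point mass `δ₁`. -/
def delta : L1Z := lp.single 1 (1 : ℤ) (1 : ℂ)

lemma single_mul_single (i j : ℤ) :
    (lp.single 1 i (1 : ℂ) : L1Z) * lp.single 1 j (1 : ℂ) = lp.single 1 (i + j) (1 : ℂ) := by
  ext m
  rw [mul_apply, tsum_eq_single i]
  · rw [lp.single_apply, lp.single_apply, lp.single_apply, Pi.single_eq_same, one_mul]
    by_cases h : m = i + j
    · subst h; simp
    · rw [Pi.single_eq_of_ne h, Pi.single_eq_of_ne (by omega)]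
  · intro k hk
    rw [lp.single_apply, Pi.single_eq_of_ne hk, zero_mul]

lemma delta_pow (n : ℕ) : delta ^ n = (lp.single 1 (n : ℤ) (1 : ℂ) : L1Z) := by
  induction n with
  | zero => rfl
  | succ n ih => rw [pow_succ, ih, delta, single_mul_single]; push_cast; rfl

lemma norm_delta_pow (n : ℕ) : ‖delta ^ n‖ ≤ 1 := by
  rw [delta_pow, lp.norm_single (by simp), norm_one]

lemma SuppNonneg.hasSum_delta {F : L1Z} (hF : F.SuppNonneg) :
    HasSum (fun k : ℕ => F (k : ℤ) • delta ^ k) F := by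
  have h := lp.hasSum_single (p := 1) (by simp) F
  rw [← Nat.cast_injective.hasSum_iff (g := ((↑) : ℕ → ℤ))] at h
  · convert! h using 2 with k
    rw [delta_pow, Function.comp_apply, ← lp.single_smul, smul_eq_mul, mul_one]
  · intro k hk
    have hFk : F k = 0 := by
      by_contra hne
      exact hk (hF.support_subset_range (f := F) (fun _ h => h) hne)
    rw [hFk]
    exact lp.single_zero 1 k

/-- A continuous linear multiplicative map out of `L¹(ℤ)` is determined by its value at `δ₁`. -/
lemma SuppNonneg.map_eq_powSeries {F : L1Z} (hF : F.SuppNonneg) {B : Type*} [NormedRing B]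
    [NormedAlgebra ℂ B] (Φ : L1Z →L[ℂ] B) (hpow : ∀ (G : L1Z) (n : ℕ), Φ (G ^ n) = Φ G ^ n) :
    Φ F = powSeries F (Φ delta) := by
  have h := hF.hasSum_delta.mapL Φ
  rw [powSeries, ← h.tsum_eq]
  refine tsum_congr fun k => ?_
  rw [map_smul, hpow]

lemma SuppNonneg.fourierZ_eq {F : L1Z} (hF : F.SuppNonneg) (ξ : ℝ) :
    fourierZ F ξ = genFun F (Complex.exp (-Complex.I * ξ)) := by
  rw [fourierZ, genFun, ← Nat.cast_injective.tsum_eq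
    (hF.support_subset_range fun k hk => by rw [hk, zero_mul])]
  refine tsum_congr fun k => ?_
  rw [← Complex.exp_nat_mul]
  congr 2
  push_cast
  ring

end L1Z

/-! ### Probabilities and scalar Ritt estimates. -/

section ProbZPlus

variable {F : L1Z}

lemma suppNonneg_of_mem_probZPlus (hF : F ∈ probZPlus) : F.SuppNonneg := by
  intro k hk
  by_contra h
  exact absurd (hF.2.2 h) (not_le.2 hk)

lemma norm_apply_of_mem_probZPlus (hF : F ∈ probZPlus) (k : ℤ) : ((‖F k‖ : ℝ) : ℂ) = F k := by
  have h := hF.1 k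
  rw [Complex.norm_of_nonneg' h]

lemma re_apply_of_mem_probZPlus (hF : F ∈ probZPlus) (k : ℤ) : (F k).re = ‖F k‖ := by
  rw [← norm_apply_of_mem_probZPlus hF k]
  simp

lemma norm_of_mem_probZPlus (hF : F ∈ probZPlus) : ‖F‖ = 1 := by
  have h : ((‖F‖ : ℝ) : ℂ) = 1 := by
    rw [norm_eq, Complex.ofReal_tsum, ← hF.2.1]
    exact tsum_congr fun k => norm_apply_of_mem_probZPlus hF k
  exact_mod_cast h

lemma norm_genFun_le_one (hF : F ∈ probZPlus) {w : ℂ} (hw : ‖w‖ ≤ 1) : ‖genFun F w‖ ≤ 1 := by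
  have h := norm_powSeries_le F (norm_pow_le_one hw)
  rwa [norm_of_mem_probZPlus hF, one_mul] at h

lemma genFun_ritt_bound (hF : F ∈ probZPlus) {C : ℝ}
    (hC : ∀ n : ℕ, 1 ≤ n → n * ‖F ^ n - F ^ (n + 1)‖ ≤ C) {w : ℂ} (hw : ‖w‖ ≤ 1) (n : ℕ)
    (hn : 1 ≤ n) : n * ‖genFun F w ^ n - genFun F w ^ (n + 1)‖ ≤ C := by
  have h := norm_powSeries_pow_sub_le (suppNonneg_of_mem_probZPlus hF)
    (norm_pow_le_one hw) n
  rw [mul_one] at h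
  exact (mul_le_mul_of_nonneg_left h (by positivity)).trans (hC n hn)

end ProbZPlus

section Scalar

variable {l : ℂ} {C : ℝ}

/-- If `|l| = 1`, the differences `|l^n - l^(n+1)| = |1 - l|` do not decay, so `l = 1`. -/
lemma mem_discOne_of_ritt (hl : ‖l‖ ≤ 1)
    (hC : ∀ n : ℕ, 1 ≤ n → n * ‖l ^ n - l ^ (n + 1)‖ ≤ C) : l ∈ discOne := by
  rcases hl.lt_or_eq with h | h
  · exact Or.inl (by simpa using h)
  · refine Or.inr ?_
    by_contra hne
    have hpos : 0 < ‖1 - l‖ := norm_pos_iff.2 (sub_ne_zero.2 (Ne.symm hne))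
    obtain ⟨n, hn⟩ := exists_nat_gt (C / ‖1 - l‖)
    rw [div_lt_iff₀ hpos] at hn
    have h1 := hC (n + 1) (by omega)
    have h2 : l ^ (n + 1) - l ^ (n + 1 + 1) = l ^ (n + 1) * (1 - l) := by ring
    rw [h2, norm_mul, norm_pow, h, one_pow, one_mul] at h1
    push_cast at h1
    linarith

/-- A scalar satisfying a Ritt estimate lies in a Stolz sector. -/
lemma norm_one_sub_le_of_ritt (hl : ‖l‖ ≤ 1)
    (hC : ∀ n : ℕ, 1 ≤ n → n * ‖l ^ n - l ^ (n + 1)‖ ≤ C) :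
    ‖1 - l‖ ≤ (8 * C + 4) * (1 - l).re := by
  have hC0 : 0 ≤ C := le_trans (by positivity) (hC 1 le_rfl)
  have hre : (1 - l).re = 1 - l.re := by simp
  set x := (1 - l).re with hx
  have hlx : 1 - x ≤ ‖l‖ := by
    have := Complex.re_le_norm l
    linarith
  have hx0 : 0 ≤ x := by
    have := Complex.re_le_norm l
    linarith
  rcases le_or_gt x (1 / 2) with hx2 | hx2
  · rcases hx0.eq_or_lt with h0 | h0
    · have h1 : ‖l‖ ^ 2 ≤ 1 := pow_le_one₀ (norm_nonneg _) hl
      rw [← Complex.normSq_eq_norm_sq, Complex.normSq_apply] at h1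
      have h2 : l.re = 1 := by linarith
      have h3 : l.im = 0 := by
        rw [h2] at h1
        nlinarith [sq_nonneg l.im]
      have h4 : l = 1 := Complex.ext (by simpa using h2) (by simpa using h3)
      rw [h4, sub_self, norm_zero]
      positivity
    -- The largest `n` for which Bernoulli's inequality still gives `|l|^n ≥ (1 - x)^n ≥ 1 - n x ≥
    -- 1/2`.
    set n := ⌊1 / (2 * x)⌋₊ with hn
    have h1 : (1 : ℝ) ≤ 1 / (2 * x) := by
      rw [le_div_iff₀ (by positivity)]
      linarith
    have hn1 : 1 ≤ n := Nat.le_floor (by exact_mod_cast h1)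
    have hn1' : (1 : ℝ) ≤ n := by exact_mod_cast hn1
    have hnle : (n : ℝ) * (2 * x) ≤ 1 :=
      (le_div_iff₀ (by positivity)).1 (Nat.floor_le (by positivity))
    have hnge : 1 < ((n : ℝ) + 1) * (2 * x) :=
      (div_lt_iff₀ (by positivity)).1 (Nat.lt_floor_add_one _)
    have hb := one_add_mul_le_pow (a := -x) (by linarith) n
    have hp : 1 / 2 ≤ ‖l‖ ^ n := by
      have : (1 + -x) ^ n ≤ ‖l‖ ^ n := pow_le_pow_left₀ (by linarith) (by linarith) n
      nlinarith
    have h2 := hC n hn1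
    have h3 : l ^ n - l ^ (n + 1) = l ^ n * (1 - l) := by ring
    rw [h3, norm_mul, norm_pow] at h2
    have h4 : (n : ℝ) * (1 / 2 * ‖1 - l‖) ≤ C :=
      (mul_le_mul_of_nonneg_left (mul_le_mul_of_nonneg_right hp (norm_nonneg _))
        (by positivity)).trans h2
    have h5 : 1 ≤ 4 * x * n := by nlinarith
    have h6 : ‖1 - l‖ ≤ 4 * x * n * ‖1 - l‖ := le_mul_of_one_le_left (norm_nonneg _) h5
    nlinarith
  · have h1 : ‖1 - l‖ ≤ 2 := (norm_sub_le _ _).trans (by rw [norm_one]; linarith)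
    nlinarith

/-- For `z ≠ 0`, `cos (Arg z) = Re z / |z| ≥ 1 / K`. -/
lemma mem_closedSector_of_norm_le {z : ℂ} {K : ℝ} (hK : 0 < K) (hz : ‖z‖ ≤ K * z.re) :
    z ∈ closedSector (Real.arccos K⁻¹) := by
  rcases eq_or_ne z 0 with rfl | h0
  · exact Or.inl rfl
  refine Or.inr ?_
  have hzpos : 0 < ‖z‖ := norm_pos_iff.2 h0
  have hcos : K⁻¹ ≤ Real.cos |z.arg| := by
    rw [Real.cos_abs, Complex.cos_arg h0, inv_eq_one_div, div_le_div_iff₀ hK hzpos]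
    linarith
  have h1 := Real.arccos_le_arccos hcos
  rwa [Real.arccos_cos (abs_nonneg _) (Complex.abs_arg_le_pi z)] at h1

end Scalar

/-! ### Convolution operators and `Ψ(F; T)`. -/

section Operators

lemma convOp_apply (F G : L1Z) : convOp F G = F * G := rfl

lemma convOp_pow (F : L1Z) (n : ℕ) : convOp F ^ n = convOp (F ^ n) := by
  induction n with
  | zero => ext1 G; simp [convOp_apply]
  | succ n ih =>
    ext1 G
    rw [pow_succ, ih, pow_succ]
    simp [convOp_apply, mul_assoc]

lemma norm_convOp (F : L1Z) : ‖convOp F‖ = ‖F‖ := by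
  refine le_antisymm (ContinuousLinearMap.opNorm_mul_apply_le ℂ L1Z F) ?_
  have h := (convOp F).le_opNorm 1
  rwa [convOp_apply, mul_one, norm_one, mul_one] at h

lemma convOp_sub (F G : L1Z) : convOp (F - G) = convOp F - convOp G := by
  ext1 H
  simp [convOp_apply, sub_mul]

lemma norm_convOp_pow_sub (F : L1Z) (n : ℕ) :
    ‖convOp F ^ n - convOp F ^ (n + 1)‖ = ‖F ^ n - F ^ (n + 1)‖ := by
  rw [convOp_pow, convOp_pow, ← convOp_sub, norm_convOp]

lemma mem_classA_iff_isRitt_convOp {F : L1Z} (hF : F ∈ probZPlus) :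
    F ∈ classA ↔ IsRitt (convOp F) := by
  constructor
  · rintro ⟨-, C, hC⟩
    refine ⟨⟨1, fun n _ => ?_⟩, C, fun n hn => ?_⟩
    · rw [convOp_pow, norm_convOp]
      exact norm_pow_le_one (norm_of_mem_probZPlus hF).le n
    · rw [norm_convOp_pow_sub]
      exact hC n hn
  · rintro ⟨-, C, hC⟩
    refine ⟨hF, C, fun n hn => ?_⟩
    rw [← norm_convOp_pow_sub]
    exact hC n hn

lemma IsPowerBounded.exists_norm_pow_le {B : Type*} [NormedRing B] {b : B}
    (hb : IsPowerBounded b) : ∃ M : ℝ, ∀ k : ℕ, ‖b ^ k‖ ≤ M := by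
  obtain ⟨C, hC⟩ := hb
  refine ⟨max C ‖(1 : B)‖, fun k => ?_⟩
  rcases Nat.eq_zero_or_pos k with rfl | hk
  · rw [pow_zero]
    exact le_max_right _ _
  · exact (hC k hk).trans (le_max_left _ _)

lemma Psi_eq_powSeries (F : L1Z) {X : Type*} [NormedAddCommGroup X] [NormedSpace ℂ X]
    (T : X →L[ℂ] X) : Psi F T = powSeries F T := rfl

lemma isRitt_Psi {F : L1Z} (hF : F ∈ classA) {X : Type*} [NormedAddCommGroup X]
    [NormedSpace ℂ X] [CompleteSpace X] {T : X →L[ℂ] X} (hT : IsPowerBounded T) :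
    IsRitt (Psi F T) := by
  obtain ⟨hFp, C, hC⟩ := hF
  obtain ⟨M, hM⟩ := hT.exists_norm_pow_le
  have hM0 : 0 ≤ M := (norm_nonneg _).trans (hM 0)
  have hs := suppNonneg_of_mem_probZPlus hFp
  rw [Psi_eq_powSeries]
  refine ⟨⟨M, fun n _ => ?_⟩, C * M, fun n hn => ?_⟩
  · rw [← powSeries_pow hs hM]
    refine (norm_powSeries_le _ hM).trans (mul_le_of_le_one_left hM0 ?_)
    exact norm_pow_le_one (norm_of_mem_probZPlus hFp).le n
  · calc (n : ℝ) * ‖powSeries F T ^ n - powSeries F T ^ (n + 1)‖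
        ≤ n * (‖F ^ n - F ^ (n + 1)‖ * M) := by
          gcongr
          exact norm_powSeries_pow_sub_le hs hM n
      _ = n * ‖F ^ n - F ^ (n + 1)‖ * M := by ring
      _ ≤ C * M := mul_le_mul_of_nonneg_right (hC n hn) hM0

universe u

/-- The convolution operators, on a copy of `L¹(ℤ)` in an arbitrary universe. -/
def convOpULift : L1Z →L[ℂ] (ULift.{u} L1Z →L[ℂ] ULift.{u} L1Z) :=
  let e : L1Z ≃L[ℂ] ULift.{u} L1Z :=
    (ContinuousLinearEquiv.ulift : ULift.{u} L1Z ≃L[ℂ] L1Z).symm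
  (e.arrowCongr e : (L1Z →L[ℂ] L1Z) →L[ℂ] (ULift.{u} L1Z →L[ℂ] ULift.{u} L1Z)) ∘L
    ContinuousLinearMap.mul ℂ L1Z

lemma convOpULift_apply (F : L1Z) (G : ULift.{u} L1Z) :
    convOpULift F G = ULift.up (F * G.down) := rfl

lemma convOpULift_pow (F : L1Z) (n : ℕ) :
    convOpULift.{u} (F ^ n) = convOpULift F ^ n := by
  induction n with
  | zero => ext1 G; simp [convOpULift_apply]
  | succ n ih =>
    ext1 G
    rw [pow_succ, pow_succ, ← ih]
    simp [convOpULift_apply, mul_assoc]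

lemma norm_convOpULift (F : L1Z) : ‖convOpULift.{u} F‖ = ‖F‖ := by
  refine le_antisymm (ContinuousLinearMap.opNorm_le_bound _ (norm_nonneg _) fun G => ?_) ?_
  · rw [convOpULift_apply, ULift.norm_up, ← ULift.norm_down G]
    exact norm_mul_le _ _
  · have h := (convOpULift.{u} F).le_opNorm (ULift.up 1)
    rwa [convOpULift_apply, mul_one, ULift.norm_up, ULift.norm_up, norm_one, mul_one] at h

lemma convOpULift_eq_powSeries {F : L1Z} (hF : F.SuppNonneg) :
    convOpULift.{u} F = powSeries F (convOpULift.{u} delta) :=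
  hF.map_eq_powSeries (B := ULift.{u} L1Z →L[ℂ] ULift.{u} L1Z) convOpULift convOpULift_pow

/-- Test on convolution by `δ₁`, for which `Ψ(F; T)` is convolution by `F`. The lift is needed
because the spaces `X` range over an arbitrary fixed universe. -/
lemma mem_classA_of_isRitt_Psi {F : L1Z} (hF : F ∈ probZPlus)
    (h : ∀ (X : Type u) [NormedAddCommGroup X] [NormedSpace ℂ X] [CompleteSpace X]
      (T : X →L[ℂ] X), IsPowerBounded T → IsRitt (Psi F T)) : F ∈ classA := by
  have hT : IsPowerBounded (convOpULift.{u} delta) := by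
    refine ⟨1, fun n _ => ?_⟩
    rw [← convOpULift_pow, norm_convOpULift]
    exact norm_delta_pow n
  obtain ⟨-, C, hC⟩ := h _ _ hT
  rw [Psi_eq_powSeries, ← convOpULift_eq_powSeries (suppNonneg_of_mem_probZPlus hF)] at hC
  refine ⟨hF, C, fun n hn => ?_⟩
  have := hC n hn
  rwa [← convOpULift_pow, ← convOpULift_pow, ← map_sub, norm_convOpULift] at this

end Operators

/-! ### Characters and the Fourier condition. -/

section Spectrum

/-- The characters of `L¹(ℤ)` evaluate the generating function at points of the unit circle. -/
lemma exists_character_eq_genFun (χ : WeakDual.characterSpace ℂ L1Z) :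
    ∃ w : ℂ, ‖w‖ = 1 ∧ ∀ F : L1Z, F.SuppNonneg → χ F = genFun F w := by
  refine ⟨χ delta, le_antisymm ?_ ?_, fun F hF => ?_⟩
  · refine (AlgHom.norm_apply_le_self χ delta).trans ?_
    simpa using norm_delta_pow 1
  · have h1 : χ delta * χ (lp.single 1 (-1 : ℤ) (1 : ℂ) : L1Z) = 1 := by
      rw [← map_mul, delta, single_mul_single, add_neg_cancel]
      exact map_one χ
    have h2 : ‖χ (lp.single 1 (-1 : ℤ) (1 : ℂ) : L1Z)‖ ≤ 1 := by
      refine (AlgHom.norm_apply_le_self χ _).trans ?_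
      rw [lp.norm_single (by simp), norm_one]
    have h3 := congrArg norm h1
    rw [norm_mul, norm_one] at h3
    nlinarith [norm_nonneg (χ delta)]
  · exact hF.map_eq_powSeries (WeakDual.CharacterSpace.toCLM χ) fun G n => map_pow χ G n

lemma exists_angle_of_norm_eq_one {w : ℂ} (hw : ‖w‖ = 1) :
    ∃ ξ ∈ Set.Icc (-Real.pi) Real.pi, Complex.exp (-Complex.I * ξ) = w := by
  refine ⟨-w.arg, ⟨neg_le_neg (Complex.arg_le_pi w), ?_⟩, ?_⟩
  · linarith [Complex.neg_pi_lt_arg w]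
  · have h := Complex.norm_mul_exp_arg_mul_I w
    rw [hw, Complex.ofReal_one, one_mul] at h
    rw [← h, Complex.ofReal_neg, neg_mul_neg, mul_comm]
    simp [h]

/-- A non-invertible element is killed by some character, giving `z φ_F(w) = 1` with `|w| = 1`. Then
`|φ_F(w)| = 1`, so `φ_F(w) = 1` and `z = 1`. -/
lemma isUnit_one_sub_smul_of_fourierZ_mem {F : L1Z} (hF : F ∈ probZPlus)
    (h : ∀ ξ ∈ Set.Icc (-Real.pi) Real.pi, fourierZ F ξ ∈ discOne) {z : ℂ} (hz : ‖z‖ = 1)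
    (hz1 : z ≠ 1) : IsUnit (1 - z • F) := by
  by_contra hu
  obtain ⟨χ, hχ⟩ := WeakDual.CharacterSpace.exists_apply_eq_zero hu
  obtain ⟨w, hw, hχw⟩ := exists_character_eq_genFun χ
  have hs := suppNonneg_of_mem_probZPlus hF
  obtain ⟨ξ, hξ, rfl⟩ := exists_angle_of_norm_eq_one hw
  have hmem := h ξ hξ
  rw [map_sub, map_one, map_smul, hχw F hs, ← hs.fourierZ_eq, smul_eq_mul, sub_eq_zero] at hχ
  rcases hmem with hlt | heq
  · have h2 := congrArg norm hχ
    rw [norm_mul, hz, norm_one, one_mul] at h2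
    rw [mem_ball_zero_iff, ← h2] at hlt
    exact lt_irrefl _ hlt
  · rw [Set.mem_singleton_iff.1 heq, mul_one] at hχ
    exact hz1 hχ.symm

lemma mem_classA_iff_fourierZ_and_exp {F : L1Z} (hF : F ∈ probZPlus) :
    F ∈ classA ↔ (∀ ξ ∈ Set.Icc (-Real.pi) Real.pi, fourierZ F ξ ∈ discOne) ∧
      ∃ C : ℝ, ∀ t : ℝ, 1 ≤ t →
        t * ‖(1 - F) * NormedSpace.exp (-(t : ℂ) • (1 - F))‖ ≤ C := by
  have hs := suppNonneg_of_mem_probZPlus hF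
  have hnorm : ‖F‖ ≤ 1 := (norm_of_mem_probZPlus hF).le
  constructor
  · rintro ⟨-, C, hC⟩
    refine ⟨fun ξ _ => ?_, 2 * C + 2, fun t ht =>
      norm_one_sub_mul_exp_le_of_ritt hnorm hC (by linarith)⟩
    rw [hs.fourierZ_eq]
    have hw : ‖Complex.exp (-Complex.I * ξ)‖ ≤ 1 := by
      rw [Complex.norm_exp]
      simp
    exact mem_discOne_of_ritt (norm_genFun_le_one hF hw) (genFun_ritt_bound hF hC hw)
  · rintro ⟨hξ, C, hC⟩
    -- For `t < 1` the bound `2` comes from `‖1 - F‖ ≤ 2` and contractivity of the semigroup.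
    have hC' : ∀ t : ℝ, 0 ≤ t →
        t * ‖(1 - F) * NormedSpace.exp (-(t : ℂ) • (1 - F))‖ ≤ max C 2 := by
      intro t ht
      rcases le_or_gt 1 t with h1 | h1
      · exact (hC t h1).trans (le_max_left _ _)
      · refine le_trans ?_ (le_max_right _ _)
        have h2 : ‖1 - F‖ ≤ 2 := (norm_sub_le _ _).trans (by rw [norm_one]; linarith)
        have h3 := norm_exp_neg_smul_le_one hnorm ht
        have h4 : ‖(1 - F) * NormedSpace.exp (-(t : ℂ) • (1 - F))‖ ≤ 2 * 1 :=
          (norm_mul_le _ _).trans (mul_le_mul h2 h3 (norm_nonneg _) (by norm_num))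
        nlinarith [norm_nonneg ((1 - F) * NormedSpace.exp (-(t : ℂ) • (1 - F)))]
    obtain ⟨K, hK0, hK⟩ := exists_norm_inverse_one_sub_smul_le hnorm
      (fun z hz hz1 => isUnit_one_sub_smul_of_fourierZ_mem hF hξ hz hz1) hC'
    exact ⟨hF, exists_ritt_bound_of_norm_inverse_le hnorm hK0 hK⟩

end Spectrum

/-! ### The sector for `φ_F` and the first moment. -/

section FirstMoment

lemma exists_norm_one_sub_genFun_le {F : L1Z} (hF : F ∈ classA) :
    ∃ K : ℝ, 1 < K ∧ ∀ w : ℂ, ‖w‖ ≤ 1 → ‖1 - genFun F w‖ ≤ K * (1 - genFun F w).re := by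
  obtain ⟨hFp, C, hC⟩ := hF
  have hC0 : 0 ≤ C := le_trans (by positivity) (hC 1 le_rfl)
  exact ⟨8 * C + 4, by linarith, fun w hw =>
    norm_one_sub_le_of_ritt (norm_genFun_le_one hFp hw) (genFun_ritt_bound hFp hC hw)⟩

lemma exists_sector {F : L1Z} (hF : F ∈ classA) :
    ∃ θ : ℝ, 0 < θ ∧ θ < Real.pi / 2 ∧
      ∀ w : ℂ, ‖w‖ ≤ 1 → genFun F w ∈ discOne ∧ 1 - genFun F w ∈ closedSector θ := by
  obtain ⟨K, hK1, hK⟩ := exists_norm_one_sub_genFun_le hF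
  obtain ⟨hFp, C, hC⟩ := hF
  have hK0 : 0 < K := by linarith
  refine ⟨Real.arccos K⁻¹, Real.arccos_pos.2 (inv_lt_one_of_one_lt₀ hK1),
    Real.arccos_lt_pi_div_two.2 (inv_pos.2 hK0), fun w hw => ⟨?_, ?_⟩⟩
  · exact mem_discOne_of_ritt (norm_genFun_le_one hFp hw) (genFun_ritt_bound hFp hC hw)
  · exact mem_closedSector_of_norm_le hK0 (hK w hw)

/-- A finite first moment is the derivative at `0` of `t ↦ φ_F(e^{it})`, up to the factor `i`. -/
lemma tendsto_genFun_slope {F : L1Z} (hF : F ∈ probZPlus)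
    (hm : Summable fun k : ℕ => (k : ℝ) * ‖F (k : ℤ)‖) :
    Filter.Tendsto (fun t : ℝ => (t : ℂ)⁻¹ * (genFun F (Complex.exp (Complex.I * t)) - 1))
      (nhdsWithin 0 {0}ᶜ)
      (nhds (Complex.I * ((∑' k : ℕ, (k : ℝ) * ‖F (k : ℤ)‖ : ℝ) : ℂ))) := by
  have hs := suppNonneg_of_mem_probZPlus hF
  have hsum1 : ∑' k : ℕ, F (k : ℤ) = 1 := by
    rw [← hF.2.1]
    exact Nat.cast_injective.tsum_eq (hs.support_subset_range fun _ h => h)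
  have hser : ∀ t : ℝ, (t : ℂ)⁻¹ * (genFun F (Complex.exp (Complex.I * t)) - 1) =
      ∑' k : ℕ, F (k : ℤ) * ((t : ℂ)⁻¹ * (Complex.exp (Complex.I * ((k * t : ℝ) : ℂ)) - 1)) := by
    intro t
    have hw : ‖Complex.exp (Complex.I * t)‖ ≤ 1 := by
      rw [Complex.norm_exp]
      simp
    have h1 : Summable fun k : ℕ => F (k : ℤ) * Complex.exp (Complex.I * t) ^ k :=
      (summable_norm_powSeries F (b := Complex.exp (Complex.I * t)) (norm_pow_le_one hw)).of_norm
    rw [genFun, ← hsum1, ← h1.tsum_sub F.summable_norm_nat.of_norm, ← tsum_mul_left]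
    refine tsum_congr fun k => ?_
    rw [← Complex.exp_nat_mul]
    push_cast
    ring_nf
  have hlim : Complex.I * ((∑' k : ℕ, (k : ℝ) * ‖F (k : ℤ)‖ : ℝ) : ℂ) =
      ∑' k : ℕ, F (k : ℤ) * (Complex.I * k) := by
    rw [Complex.ofReal_tsum, ← tsum_mul_left]
    refine tsum_congr fun k => ?_
    rw [Complex.ofReal_mul, norm_apply_of_mem_probZPlus hF, Complex.ofReal_natCast]
    ring
  rw [hlim]
  simp only [hser]
  -- The domination is `|e^{ikt} - 1| ≤ k |t|`.
  refine tendsto_tsum_of_dominated_convergence hm (fun k => ?_) ?_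
  · refine Filter.Tendsto.const_mul _ ?_
    have hd : HasDerivAt (fun t : ℝ => Complex.exp (Complex.I * ((k * t : ℝ) : ℂ)))
        (Complex.I * k) 0 := by
      have h1 : HasDerivAt (fun t : ℂ => Complex.exp (Complex.I * (k * t))) (Complex.I * k)
          ((0 : ℝ) : ℂ) := by
        have h2 := (((hasDerivAt_id (((0 : ℝ) : ℂ))).const_mul (k : ℂ)).const_mul
          Complex.I).cexp
        simpa using h2
      simpa using h1.comp_ofReal
    have h3 := hasDerivAt_iff_tendsto_slope_zero.1 hd
    refine h3.congr fun t => ?_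
    simp
  · filter_upwards [self_mem_nhdsWithin] with t ht k
    have ht0 : 0 < |t| := abs_pos.2 ht
    rw [norm_mul, norm_mul, norm_inv, Complex.norm_real, mul_comm (k : ℝ) ‖F (k : ℤ)‖]
    refine mul_le_mul_of_nonneg_left ?_ (norm_nonneg _)
    have h1 := Real.norm_exp_I_mul_ofReal_sub_one_le (x := k * t)
    rw [norm_mul, Real.norm_natCast] at h1
    rw [Real.norm_eq_abs] at h1 ⊢
    rw [inv_mul_le_iff₀ ht0]
    linarith

/-- Dividing the sector inequality at `e^{it}` by `t` and letting `t ↓ 0` yields `m ≤ -K Re (i m) =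
0`. -/
lemma tsum_moment_eq_zero {F : L1Z} (hF : F ∈ classA)
    (hm : Summable fun k : ℕ => (k : ℝ) * ‖F (k : ℤ)‖) :
    ∑' k : ℕ, (k : ℝ) * ‖F (k : ℤ)‖ = 0 := by
  obtain ⟨K, hK1, hK⟩ := exists_norm_one_sub_genFun_le hF
  have hlim := (tendsto_genFun_slope hF.1 hm).mono_left
    (nhdsWithin_mono (0 : ℝ) (s := Set.Ioi 0) fun t ht => ne_of_gt ht)
  set m := ∑' k : ℕ, (k : ℝ) * ‖F (k : ℤ)‖
  have hm0 : 0 ≤ m := tsum_nonneg fun k => by positivity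
  have hre := ((Complex.continuous_re.tendsto _).comp hlim).const_mul (-K)
  have hle := le_of_tendsto_of_tendsto hlim.norm hre ?_
  · simp at hle
    linarith
  · filter_upwards [self_mem_nhdsWithin] with t ht
    have ht0 : 0 < t := ht
    have hw : ‖Complex.exp (Complex.I * t)‖ ≤ 1 := by
      rw [Complex.norm_exp]
      simp
    have h1 := hK _ hw
    rw [norm_sub_rev] at h1
    have h2 : ((t : ℂ)⁻¹ * (genFun F (Complex.exp (Complex.I * t)) - 1)).re =
        -(t⁻¹ * (1 - genFun F (Complex.exp (Complex.I * t))).re) := by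
      rw [← Complex.ofReal_inv, Complex.re_ofReal_mul]
      simp
      ring
    rw [Function.comp_apply, h2, norm_mul, norm_inv, Complex.norm_real, Real.norm_of_nonneg ht0.le]
    calc t⁻¹ * ‖genFun F (Complex.exp (Complex.I * t)) - 1‖
        ≤ t⁻¹ * (K * (1 - genFun F (Complex.exp (Complex.I * t))).re) := by gcongr
      _ = _ := by ring

lemma eq_one_of_summable_moment {F : L1Z} (hF : F ∈ classA)
    (hm : Summable fun k : ℕ => (k : ℝ) * ‖F (k : ℤ)‖) : F = 1 := by
  have hs := suppNonneg_of_mem_probZPlus hF.1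
  have hzero : ∀ k : ℤ, k ≠ 0 → F k = 0 := by
    intro k hk
    rcases lt_or_ge k 0 with h | h
    · exact hs k h
    lift k to ℕ using h
    have h1 := hm.le_tsum k fun j _ => by positivity
    rw [tsum_moment_eq_zero hF hm] at h1
    have hk0 : (0 : ℝ) < k := by
      have : k ≠ 0 := by exact_mod_cast hk
      exact_mod_cast Nat.pos_of_ne_zero this
    have h2 : ‖F (k : ℤ)‖ ≤ 0 := by
      by_contra h3
      exact absurd h1 (not_le.2 (mul_pos hk0 (not_le.1 h3)))
    exact norm_le_zero_iff.1 h2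
  have h0 : F 0 = 1 := by
    rw [← hF.1.2.1, tsum_eq_single 0 hzero]
  ext k
  rw [one_apply]
  split_ifs with hk
  · rw [hk, h0]
  · exact hzero k hk

lemma tsum_moment_eq_top {F : L1Z} (hF : F ∈ classA) (hne : F ≠ 1) :
    ∑' k : ℕ, (k : ℝ≥0∞) * ENNReal.ofReal (F (k : ℤ)).re = ⊤ := by
  by_contra h
  refine hne (eq_one_of_summable_moment hF ((ENNReal.summable_toReal h).congr fun k => ?_))
  rw [ENNReal.toReal_mul, ENNReal.toReal_natCast, re_apply_of_mem_probZPlus hF.1,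
    ENNReal.toReal_ofReal (norm_nonneg _)]

lemma infinite_support {F : L1Z} (hF : F ∈ classA) (hne : F ≠ 1) :
    (Function.support (F : ℤ → ℂ)).Infinite := by
  intro hfin
  refine hne (eq_one_of_summable_moment hF (summable_of_hasFiniteSupport ?_))
  refine (hfin.preimage (f := ((↑) : ℕ → ℤ)) Nat.cast_injective.injOn).subset fun k hk => ?_
  intro h0
  exact hk (by simp [h0])

end FirstMoment

end RittProb

end

theorem theorem4p1 (F : RittProb.L1Z) (hF : F ∈ RittProb.probZPlus) :
    List.TFAE
      [ F ∈ RittProb.classA,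
        RittProb.IsRitt (RittProb.convOp F),
        ∀ (X : Type*) [NormedAddCommGroup X] [NormedSpace ℂ X] [CompleteSpace X]
          (T : X →L[ℂ] X),
          RittProb.IsPowerBounded T → RittProb.IsRitt (RittProb.Psi F T),
        (∀ ξ ∈ Set.Icc (-Real.pi) Real.pi, RittProb.fourierZ F ξ ∈ RittProb.discOne) ∧
          ∃ C : ℝ, ∀ t : ℝ, 1 ≤ t →
            t * ‖(1 - F) * NormedSpace.exp (-(t : ℂ) • (1 - F))‖ ≤ C ] ∧
    (F ∈ RittProb.classA →
      ∃ θ : ℝ, 0 < θ ∧ θ < Real.pi / 2 ∧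
        ∀ w : ℂ, ‖w‖ ≤ 1 →
          RittProb.genFun F w ∈ RittProb.discOne ∧
          1 - RittProb.genFun F w ∈ RittProb.closedSector θ) ∧
    (F ∈ RittProb.classA → F ≠ 1 →
      ∑' k : ℕ, (k : ℝ≥0∞) * ENNReal.ofReal (F (k : ℤ)).re = ⊤ ∧
      (Function.support (F : ℤ → ℂ)).Infinite) := by
  refine ⟨?_, RittProb.exists_sector, fun hA hne =>
    ⟨RittProb.tsum_moment_eq_top hA hne, RittProb.infinite_support hA hne⟩⟩
  tfae_have 1 ↔ 2 := RittProb.mem_classA_iff_isRitt_convOp hF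
  tfae_have 1 → 3 := fun hA X _ _ _ T hT => RittProb.isRitt_Psi hA hT
  tfae_have 3 → 1 := RittProb.mem_classA_of_isRitt_Psi hF
  tfae_have 1 ↔ 4 := RittProb.mem_classA_iff_fourierZ_and_exp hF
  tfae_finish
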